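/- Let $G$ be a finite connected simple undirected graph with vertex set $V$, $|V|=N$, and Laplacian matrix $L=D-A$ (degree matrix minus adjacency matrix), let $L^\dagger$ be the Moore--Penrose pseudo-inverse of $L$, and let $L^{2\dagger}=(L^\dagger)^2$. The biharmonic distance $d_B(j,k)\ge 0$ of two vertices $j,k$ is defined by $$d_B^2(j,k)=L^{2\dagger}_{jj}+L^{2\dagger}_{kk}-2L^{2\dagger}_{jk}.$$ Let $x_1(t),x_2(t)\in\mathbb{R}^N$, $t\ge 0$, be a solution, with a square-integrable initial state $(x_1(0),x_2(0))$, of the noisy second-order consensus system $$\begin{bmatrix}\dot x_1(t)\\ \dot x_2(t)\end{bmatrix}=\begin{bmatrix}0&I\\-L&-L\end{bmatrix}\begin{bmatrix}x_1(t)\\x_2(t)\end{bmatrix}+\begin{bmatrix}0\\I\end{bmatrix}w(t),$$ where $w(t)$ is an $N$-vector of uncorrelated Gaussian white noise processes of unit intensity; that is, the system holds in integrated form, almost surely for all $t\ge 0$ and with continuous paths, where the coordinates of $W(t)=\int_0^t w(s)\,ds$ are mutually uncorrelated standard Brownian motions. Then for any two vertices $j,k\in V$ the second moment $\mathbb{E}\big[(x_{1j}(t)-x_{1k}(t))^2\big]$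 is finite for every $t\ge 0$, the steady-state pairwise variance $$H_{\mathrm{SO}}(j,k)=\lim_{t\to\infty}\mathbb{E}\big[(x_{1j}(t)-x_{1k}(t))^2\big]$$ exists, and $$H_{\mathrm{SO}}(j,k)=\tfrac12\,d_B^2(j,k).$$ -/

import Mathlib

open MeasureTheory ProbabilityTheory Filter Topology
open scoped NNReal Matrix

namespace Consensus

section PseudoInverse

/-- The four Penrose equations: `X` is the Moore–Penrose pseudo-inverse of the real matrix `A`. -/
structure IsMoorePenroseInverse {V : Type*} [Fintype V] (A X : Matrix V V ℝ) : Prop where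
  mul_mul_left : A * X * A = A
  mul_mul_right : X * A * X = X
  symm_left : (A * X)ᵀ = A * X
  symm_right : (X * A)ᵀ = X * A

/-- The pseudo-inverse of a symmetric real matrix `A = U diag(μ) Uᵀ`, namely
`U diag(μ†) Uᵀ`, where `μ† = 1 / μ` for `μ ≠ 0` and `μ† = 0` for `μ = 0`
(Lean's convention `0⁻¹ = 0`). -/
noncomputable def pinv {V : Type*} [Fintype V] [DecidableEq V] {A : Matrix V V ℝ}
    (hA : A.IsHermitian) : Matrix V V ℝ :=
  (hA.eigenvectorUnitary : Matrix V V ℝ) * Matrix.diagonal (fun i => (hA.eigenvalues i)⁻¹) *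
    (hA.eigenvectorUnitary : Matrix V V ℝ)ᵀ

/-- `pinv` satisfies the Penrose equations. -/
theorem isMoorePenroseInverse_pinv {V : Type*} [Fintype V] [DecidableEq V] {A : Matrix V V ℝ}
    (hA : A.IsHermitian) : IsMoorePenroseInverse A (pinv hA) := by
  set U : Matrix V V ℝ := (hA.eigenvectorUnitary : Matrix V V ℝ) with hU
  set D : Matrix V V ℝ := Matrix.diagonal hA.eigenvalues with hD
  set E : Matrix V V ℝ := Matrix.diagonal (fun i => (hA.eigenvalues i)⁻¹) with hE
  have hUU : Uᵀ * U = 1 := by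
    have h := Unitary.coe_star_mul_self hA.eigenvectorUnitary
    rwa [Matrix.star_eq_conjTranspose, Matrix.conjTranspose_eq_transpose_of_trivial] at h
  have hspec : A = U * D * Uᵀ := by
    have h := hA.spectral_theorem
    rw [Unitary.conjStarAlgAut_apply, Matrix.star_eq_conjTranspose,
      Matrix.conjTranspose_eq_transpose_of_trivial] at h
    exact h
  have hX : pinv hA = U * E * Uᵀ := rfl
  have hmul : ∀ P Q : Matrix V V ℝ, (U * P * Uᵀ) * (U * Q * Uᵀ) = U * (P * Q) * Uᵀ := by
    intro P Q
    calc (U * P * Uᵀ) * (U * Q * Uᵀ) = U * P * (Uᵀ * U) * Q * Uᵀ := by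
          simp only [Matrix.mul_assoc]
      _ = U * (P * Q) * Uᵀ := by rw [hUU]; simp only [Matrix.mul_assoc, Matrix.one_mul]
  have hDED : D * E * D = D := by
    rw [hD, hE, Matrix.diagonal_mul_diagonal, Matrix.diagonal_mul_diagonal]
    congr 1; funext i
    exact mul_inv_mul_cancel _
  have hEDE : E * D * E = E := by
    rw [hD, hE, Matrix.diagonal_mul_diagonal, Matrix.diagonal_mul_diagonal]
    congr 1; funext i
    simpa using mul_inv_mul_cancel (hA.eigenvalues i)⁻¹
  have hDE : (D * E)ᵀ = D * E := by
    rw [hD, hE, Matrix.diagonal_mul_diagonal, Matrix.diagonal_transpose]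
  have hED : (E * D)ᵀ = E * D := by
    rw [hD, hE, Matrix.diagonal_mul_diagonal, Matrix.diagonal_transpose]
  have hT : ∀ P : Matrix V V ℝ, Pᵀ = P → (U * P * Uᵀ)ᵀ = U * P * Uᵀ := by
    intro P hP
    rw [Matrix.transpose_mul, Matrix.transpose_mul, Matrix.transpose_transpose, hP,
      Matrix.mul_assoc]
  have h1 : A * pinv hA = U * (D * E) * Uᵀ := by rw [hX, ← hmul, ← hspec]
  have h2 : pinv hA * A = U * (E * D) * Uᵀ := by rw [hX, ← hmul, ← hspec]
  refine ⟨?_, ?_, ?_, ?_⟩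
  · calc A * pinv hA * A = (U * (D * E) * Uᵀ) * (U * D * Uᵀ) := by rw [h1, ← hspec]
      _ = A := by rw [hmul, hDED, ← hspec]
  · rw [h2, hX, hmul, hEDE]
  · rw [h1]; exact hT _ hDE
  · rw [h2]; exact hT _ hED

/-- The Penrose equations have at most one solution. -/
theorem IsMoorePenroseInverse.unique {V : Type*} [Fintype V] {A X Y : Matrix V V ℝ}
    (hX : IsMoorePenroseInverse A X) (hY : IsMoorePenroseInverse A Y) : X = Y := by
  have h1 : A * X = A * Y := by
    calc A * X = (A * X)ᵀ := hX.symm_left.symm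
      _ = ((A * Y) * (A * X))ᵀ := by rw [← Matrix.mul_assoc, hY.mul_mul_left]
      _ = (A * X) * (A * Y) := by rw [Matrix.transpose_mul, hX.symm_left, hY.symm_left]
      _ = A * Y := by rw [← Matrix.mul_assoc, hX.mul_mul_left]
  have h2 : X * A = Y * A := by
    calc X * A = (X * A)ᵀ := hX.symm_right.symm
      _ = ((X * A) * (Y * A))ᵀ := by
          rw [Matrix.mul_assoc X A, ← Matrix.mul_assoc A Y A, hY.mul_mul_left]
      _ = (Y * A) * (X * A) := by rw [Matrix.transpose_mul, hX.symm_right, hY.symm_right]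
      _ = Y * A := by rw [Matrix.mul_assoc Y A, ← Matrix.mul_assoc A X A, hX.mul_mul_left]
  calc X = X * A * X := hX.mul_mul_right.symm
    _ = Y * A * Y := by rw [h2, Matrix.mul_assoc, h1, ← Matrix.mul_assoc]
    _ = Y := hY.mul_mul_right

end PseudoInverse

section Biharmonic

/-- `L†`, the pseudo-inverse of the graph Laplacian `L = D - A`. -/
noncomputable def lapPinv {V : Type*} [Fintype V] [DecidableEq V] (G : SimpleGraph V)
    [DecidableRel G.Adj] : Matrix V V ℝ :=
  pinv (G.isHermitian_lapMatrix (R := ℝ))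

/-- The biharmonic distance
`d_B(j,k) = √(L²†_jj + L²†_kk - 2 L²†_jk)`, where `L²† = (L†)²`. -/
noncomputable def biharmonicDist {V : Type*} [Fintype V] [DecidableEq V] (G : SimpleGraph V)
    [DecidableRel G.Adj] (j k : V) : ℝ :=
  Real.sqrt ((lapPinv G ^ 2) j j + (lapPinv G ^ 2) k k - 2 * (lapPinv G ^ 2) j k)

end Biharmonic

section Dynamics

/-- The drift matrix `[[0, I], [-L, -L]]`. -/
def driftMatrix {V : Type*} [Fintype V] [DecidableEq V] (G : SimpleGraph V)
    [DecidableRel G.Adj] : Matrix (V ⊕ V) (V ⊕ V) ℝ :=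
  Matrix.fromBlocks 0 1 (-G.lapMatrix ℝ) (-G.lapMatrix ℝ)

/-- The input matrix `[0; I]`. -/
def inputMatrix (V : Type*) [DecidableEq V] : Matrix (V ⊕ V) V ℝ :=
  Matrix.fromRows 0 1

/-- `W = ∫ w`, the integral of a vector `w` of mutually uncorrelated unit-intensity Gaussian white
noises: every coordinate is a standard Brownian motion, and different coordinates are
uncorrelated. (Independent standard Brownian motions are an instance.) -/
structure IsIntegratedWhiteNoise {V Ω : Type*} [MeasurableSpace Ω] (P : Measure Ω)
    (W : ℝ≥0 → Ω → V → ℝ) : Prop where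
  isBrownian : ∀ v, IsBrownianReal (fun t ω => W t ω v) P
  uncorrelated : ∀ u v, u ≠ v → ∀ s t, cov[fun ω => W s ω u, fun ω => W t ω v; P] = 0

/-- The process `X = (x₁, x₂)` (with `x₁` the `Sum.inl` and `x₂` the `Sum.inr` coordinates) solves
`dX = [[0, I], [-L, -L]] X dt + [0; I] dW`: it has continuous paths and, almost surely, for all
`t ≥ 0`, `X(t) = X(0) + ∫₀ᵗ [[0, I], [-L, -L]] X(s) ds + [0; I] W(t)`. As the noise is additive,
no stochastic integral is involved. -/
structure IsSolution {V Ω : Type*} [Fintype V] [DecidableEq V] [MeasurableSpace Ω]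
    (P : Measure Ω) (G : SimpleGraph V) [DecidableRel G.Adj] (W : ℝ≥0 → Ω → V → ℝ)
    (X : ℝ≥0 → Ω → V ⊕ V → ℝ) : Prop where
  aemeasurable : ∀ t, AEMeasurable (X t) P
  continuous_paths : ∀ᵐ ω ∂P, Continuous (fun t => X t ω)
  equation : ∀ᵐ ω ∂P, ∀ (t : ℝ≥0) (i : V ⊕ V),
    X t ω i = X 0 ω i + (∫ s in (0 : ℝ)..t, (driftMatrix G *ᵥ X s.toNNReal ω) i)
      + (inputMatrix V *ᵥ W t ω) i

/-- `H_SO(j,k)` exists and equals `h`: the second moments `E[(x₁ⱼ(t) - x₁ₖ(t))²]` are finite for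
all `t` and converge to `h` as `t → ∞`. -/
def HasPairwiseVariance {V Ω : Type*} [MeasurableSpace Ω] (P : Measure Ω)
    (X : ℝ≥0 → Ω → V ⊕ V → ℝ) (j k : V) (h : ℝ) : Prop :=
  (∀ t, Integrable (fun ω => (X t ω (Sum.inl j) - X t ω (Sum.inl k)) ^ 2) P) ∧
    Tendsto (fun t => ∫ ω, (X t ω (Sum.inl j) - X t ω (Sum.inl k)) ^ 2 ∂P) atTop (𝓝 h)

end Dynamics

end Consensus

/-!
Let `L = U diag(λ) Uᵀ`. In the eigenbasis the system decouples into the scalar oscillators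
`y' = z`, `dz = -λ (y + z) dt + db`. Let `(a, h)` solve `a' = -λ h`, `h' = a - λ h` with
`a(0) = 1`, `h(0) = 0`; then `h` is the impulse response from the noise `db/dt` to `y`. As the noise
is additive, variation of constants holds path by path (`IsModeResponse.eq_add_integral`):
`y(T) = a(T) y(0) + h(T) z(0) + ∫₀ᵀ h'(T - s) b(s) ds`.

Expanding `x₁ⱼ - x₁ₖ` with the coefficients `cₙ = Uⱼₙ - Uₖₙ` splits it into `R(t) + Z(t)`, where
`R` is linear in the initial state and `Z` in the noise. The graph being connected, a mode with
`λₙ = 0` is constant on the vertices, so `cₙ = 0`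
(`modeMatrix_eq_of_modeEigenvalue_eq_zero`); for the other modes `a` and `h` tend to `0`
(`IsModeResponse.exists_energy_le`). Hence `R(t) → 0` in `L²`, and by Cauchy–Schwarz only
`E[Z(t)²]` matters in the limit, however the initial state depends on the noise
(`tendsto_integral_sq_add`).

The covariance `E[W_u(s) W_v(r)] = δ_{uv} min(s, r)`, Fubini's theorem and integration by parts give
`E[Z(t)²] = ∑ₙ cₙ² ∫₀ᵗ hₙ²` (`IsIntegratedWhiteNoise.integral_sq_integral`); only uncorrelatedness
of the coordinates enters, not their independence. Since `(a² + λ h²)' = -2 λ² h²`, the integral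
`∫₀ᵗ hₙ²` tends to `1 / (2 λₙ²)`, and `∑ₙ cₙ² / λₙ²` is the squared biharmonic distance
(`biharmonicDist_sq`).
-/

namespace Consensus

/-! ### Response of a single mode -/

theorem tendsto_zero_of_tendsto_sq {ι : Type*} {l : Filter ι} {f : ι → ℝ}
    (h : Tendsto (fun t => f t ^ 2) l (𝓝 0)) : Tendsto f l (𝓝 0) := by
  rw [tendsto_zero_iff_abs_tendsto_zero]
  simpa [Real.sqrt_sq_eq_abs, Function.comp_def] using h.sqrt

/-- `(a, h)` are the responses of the position `y` of the oscillator `y' = z`, `z' = -l (y + z)` to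
the initial states `(y, z) = (1, 0)` and `(y, z) = (0, 1)`. They are encoded by the adjoint first
order system, which is the one needed for variation of constants. -/
structure IsModeResponse (l : ℝ) (a h : ℝ → ℝ) : Prop where
  a_zero : a 0 = 1
  h_zero : h 0 = 0
  hasDerivAt_a : ∀ t, HasDerivAt a (-l * h t) t
  hasDerivAt_h : ∀ t, HasDerivAt h (a t - l * h t) t

theorem exists_isModeResponse (l : ℝ) : ∃ a h, IsModeResponse l a h := by
  let A : (ℝ × ℝ) →L[ℝ] (ℝ × ℝ) :=
    (-l • ContinuousLinearMap.snd ℝ ℝ ℝ).prod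
      (ContinuousLinearMap.fst ℝ ℝ ℝ - l • ContinuousLinearMap.snd ℝ ℝ ℝ)
  let x : ℝ → ℝ × ℝ := fun t => NormedSpace.exp (t • A) (1, 0)
  have hx : ∀ t, HasDerivAt x (A (x t)) t := fun t => by
    have h := (hasDerivAt_exp_smul_const' (𝕂 := ℝ) A t).clm_apply
      (hasDerivAt_const t ((1 : ℝ), (0 : ℝ)))
    simpa [x] using h
  have hx0 : x 0 = (1, 0) := by simp [x]
  refine ⟨fun t => (x t).1, fun t => (x t).2, by simp [hx0], by simp [hx0], fun t => ?_,
    fun t => ?_⟩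
  · simpa [A, Function.comp_def] using
      (ContinuousLinearMap.fst ℝ ℝ ℝ).hasFDerivAt.comp_hasDerivAt t (hx t)
  · simpa [A, Function.comp_def] using
      (ContinuousLinearMap.snd ℝ ℝ ℝ).hasFDerivAt.comp_hasDerivAt t (hx t)

namespace IsModeResponse

variable {l : ℝ} {a h : ℝ → ℝ}

theorem continuous_a (H : IsModeResponse l a h) : Continuous a :=
  continuous_iff_continuousAt.2 fun t => (H.hasDerivAt_a t).continuousAt

theorem continuous_h (H : IsModeResponse l a h) : Continuous h :=
  continuous_iff_continuousAt.2 fun t => (H.hasDerivAt_h t).continuousAt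

theorem integral_sq (H : IsModeResponse l a h) (hl : 0 < l) (t : ℝ) :
    ∫ s in (0 : ℝ)..t, h s ^ 2 = 1 / (2 * l ^ 2) - (a t ^ 2 + l * h t ^ 2) / (2 * l ^ 2) := by
  have hd : ∀ s, HasDerivAt (fun s => -(a s ^ 2 + l * h s ^ 2) / (2 * l ^ 2)) (h s ^ 2) s := by
    intro s
    have h1 := ((((H.hasDerivAt_a s).pow 2).add
      (((H.hasDerivAt_h s).pow 2).const_mul l)).neg).div_const (2 * l ^ 2)
    refine h1.congr_deriv ?_
    have : l ≠ 0 := hl.ne'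
    field_simp
    push_cast
    ring
  rw [intervalIntegral.integral_eq_sub_of_hasDerivAt (fun s _ => hd s)
    ((H.continuous_h.pow 2).intervalIntegrable _ _), H.a_zero, H.h_zero]
  ring

/-- The energy `a² + l h²` decays at least like `1 / t`: for the quadratic form
`V = d a² - a h + c h²` with `V' = -(a² + h²)` and `e = 1 / (1 + l)`, the function
`V + e t (a² + l h²)` is nonincreasing. -/
theorem exists_energy_le (H : IsModeResponse l a h) (hl : 0 < l) :
    ∃ C, ∀ t, 0 < t → a t ^ 2 + l * h t ^ 2 ≤ C / t := by
  -- `c` and `d` are determined by `V' = -(a² + h²)`.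
  obtain ⟨c, hc⟩ : ∃ c, c = (1 + l) / (2 * l) := ⟨_, rfl⟩
  obtain ⟨d, hd⟩ : ∃ d, d = (l + 2 * c) / (2 * l) := ⟨_, rfl⟩
  obtain ⟨e, he⟩ : ∃ e, e = 1 / (1 + l) := ⟨_, rfl⟩
  have hc' : 2 * l * c = 1 + l := by rw [hc]; field_simp
  have hd' : 2 * l * d = l + 2 * c := by rw [hd]; field_simp
  have he' : e + e * l = 1 := by rw [he]; field_simp
  have he0 : 0 < e := by rw [he]; positivity
  have hel : 0 < e * l := by positivity
  set F : ℝ → ℝ := fun t =>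
    (d * a t ^ 2 - a t * h t + c * h t ^ 2) + e * (t * (a t ^ 2 + l * h t ^ 2)) with hF
  have hFd : ∀ t, HasDerivAt F (-(a t ^ 2 + h t ^ 2) + e * (a t ^ 2 + l * h t ^ 2)
      - 2 * e * l ^ 2 * t * h t ^ 2) t := by
    intro t
    have ha := H.hasDerivAt_a t
    have hh := H.hasDerivAt_h t
    have h1 := (((ha.pow 2).const_mul d).sub (ha.mul hh)).add ((hh.pow 2).const_mul c)
    have h2 := ((hasDerivAt_id t).mul ((ha.pow 2).add ((hh.pow 2).const_mul l))).const_mul e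
    refine (h1.add h2).congr_deriv ?_
    simp only [id, Pi.pow_apply, Pi.add_apply]
    push_cast
    linear_combination (-a t * h t) * hd' - h t ^ 2 * hc'
  have hanti : AntitoneOn F (Set.Ici 0) := by
    refine antitoneOn_of_deriv_nonpos (convex_Ici 0)
      (fun t _ => (hFd t).continuousAt.continuousWithinAt)
      (fun t _ => (hFd t).differentiableAt.differentiableWithinAt) fun t ht => ?_
    rw [interior_Ici, Set.mem_Ioi] at ht
    rw [(hFd t).deriv]
    have h1 : 0 ≤ 2 * e * l ^ 2 * t * h t ^ 2 := by positivity
    have h2 : e * a t ^ 2 ≤ 1 * a t ^ 2 := by gcongr; linarith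
    have h3 : (e * l) * h t ^ 2 ≤ 1 * h t ^ 2 := by gcongr; linarith
    linarith
  refine ⟨d / e, fun t ht => ?_⟩
  have h0 := hanti (Set.mem_Ici.2 le_rfl) (Set.mem_Ici.2 ht.le) ht.le
  have hF0 : F 0 = d := by simp [hF, H.a_zero, H.h_zero]
  have hV : 0 ≤ d * a t ^ 2 - a t * h t + c * h t ^ 2 := by
    have hc2 : 1 / 2 ≤ c := by nlinarith
    have hd2 : 1 / 2 ≤ d := by nlinarith
    nlinarith [sq_nonneg (a t - h t), sq_nonneg (a t), sq_nonneg (h t)]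
  rw [div_div, le_div_iff₀ (by positivity)]
  rw [hF0] at h0
  simp only [hF] at h0
  linarith

theorem tendsto_energy (H : IsModeResponse l a h) (hl : 0 < l) :
    Tendsto (fun t => a t ^ 2 + l * h t ^ 2) atTop (𝓝 0) := by
  obtain ⟨C, hC⟩ := H.exists_energy_le hl
  refine tendsto_of_tendsto_of_tendsto_of_le_of_le' tendsto_const_nhds
    (tendsto_const_nhds.div_atTop tendsto_id : Tendsto (fun t : ℝ => C / t) atTop (𝓝 0)) ?_ ?_
  · exact Eventually.of_forall fun t => by positivity
  · filter_upwards [eventually_gt_atTop 0] with t ht using hC t ht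

theorem tendsto_a (H : IsModeResponse l a h) (hl : 0 < l) : Tendsto a atTop (𝓝 0) :=
  tendsto_zero_of_tendsto_sq (squeeze_zero (fun t => sq_nonneg _)
    (fun t => le_add_of_nonneg_right (by positivity)) (H.tendsto_energy hl))

theorem tendsto_h (H : IsModeResponse l a h) (hl : 0 < l) : Tendsto h atTop (𝓝 0) := by
  refine tendsto_zero_of_tendsto_sq (squeeze_zero (g := fun t => (a t ^ 2 + l * h t ^ 2) / l)
    (fun t => sq_nonneg _) (fun t => ?_) ?_)
  · rw [le_div_iff₀ hl]
    nlinarith [sq_nonneg (a t)]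
  · simpa using (H.tendsto_energy hl).div_const l

theorem tendsto_integral_sq (H : IsModeResponse l a h) (hl : 0 < l) :
    Tendsto (fun t => ∫ s in (0 : ℝ)..t, h s ^ 2) atTop (𝓝 (1 / 2 * (l⁻¹) ^ 2)) := by
  simp_rw [H.integral_sq hl]
  have := ((H.tendsto_energy hl).div_const (2 * l ^ 2)).const_sub (1 / (2 * l ^ 2))
  convert this using 2
  field_simp
  ring

/-- Variation of constants for an additive input `b`, in a form free of stochastic integrals: only
`b` itself, not its differential, appears under the integral. -/
theorem eq_add_integral (H : IsModeResponse l a h) {y z b : ℝ → ℝ} (hy : Continuous y)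
    (hz : Continuous z) (hb : Continuous b)
    (hy_eq : ∀ t, 0 ≤ t → y t = y 0 + ∫ s in (0 : ℝ)..t, z s)
    (hz_eq : ∀ t, 0 ≤ t → z t = z 0 + (∫ s in (0 : ℝ)..t, (-l * y s - l * z s)) + b t)
    {T : ℝ} (hT : 0 ≤ T) :
    y T = a T * y 0 + h T * z 0 + ∫ s in (0 : ℝ)..T, (a (T - s) - l * h (T - s)) * b s := by
  set v : ℝ → ℝ := fun t => z 0 + ∫ s in (0 : ℝ)..t, (-l * y s - l * z s) with hv
  set Y : ℝ → ℝ := fun t => y 0 + ∫ s in (0 : ℝ)..t, z s with hY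
  have hc : Continuous fun s => -l * y s - l * z s := by fun_prop
  have hYd : ∀ s, HasDerivAt Y (z s) s := fun s =>
    (hz.integral_hasStrictDerivAt 0 s).hasDerivAt.const_add _
  have hvd : ∀ s, HasDerivAt v (-l * y s - l * z s) s := fun s =>
    (hc.integral_hasStrictDerivAt 0 s).hasDerivAt.const_add _
  have hsub : ∀ s, HasDerivAt (fun s => T - s) (-1) s := fun s => by
    simpa using (hasDerivAt_id s).const_sub T
  have hk : Continuous fun s => (a (T - s) - l * h (T - s)) * b s := by
    have := H.continuous_a
    have := H.continuous_h
    fun_prop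
  -- `v = z - b` is differentiable although `b` is not, and `a (T - s) Y s + h (T - s) v s` varies
  -- only through `b`.
  have hd : ∀ s ∈ Set.uIcc 0 T, HasDerivAt (fun s => a (T - s) * Y s + h (T - s) * v s)
      ((a (T - s) - l * h (T - s)) * b s) s := by
    intro s hs
    rw [Set.uIcc_of_le hT] at hs
    have h1 := ((H.hasDerivAt_a (T - s)).comp s (hsub s)).mul (hYd s)
    have h2 := ((H.hasDerivAt_h (T - s)).comp s (hsub s)).mul (hvd s)
    refine (h1.add h2).congr_deriv ?_
    have e1 : y s = Y s := hy_eq s hs.1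
    have e2 : z s = v s + b s := hz_eq s hs.1
    simp only [Function.comp]
    rw [e1, e2]
    ring
  rw [intervalIntegral.integral_eq_sub_of_hasDerivAt hd (hk.intervalIntegrable _ _)]
  have e1 : Y T = y T := (hy_eq T hT).symm
  have e2 : Y 0 = y 0 := by simp [hY]
  have e3 : v 0 = z 0 := by simp [hv]
  simp only [sub_self, sub_zero, H.a_zero, H.h_zero, e1, e2, e3]
  ring

end IsModeResponse

/-- The variance of `∫₀ᵀ g(s) B(s) ds = ∫₀ᵀ H dB` for a Brownian motion `B`, where `H' = -g` and
`H(T) = 0`. The inner and the outer integral are each integrated by parts. -/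
theorem integral_integral_mul_min {H g : ℝ → ℝ} (hg : Continuous g)
    (hH : ∀ s, HasDerivAt H (-g s) s) {T : ℝ} (hT : 0 ≤ T) (hHT : H T = 0) :
    ∫ s in (0 : ℝ)..T, ∫ r in (0 : ℝ)..T, g s * g r * min s r = ∫ s in (0 : ℝ)..T, H s ^ 2 := by
  have hHc : Continuous H := continuous_iff_continuousAt.2 fun t => (hH t).continuousAt
  set M : ℝ → ℝ := fun s => ∫ r in (0 : ℝ)..s, H r with hM
  have hMd : ∀ s, HasDerivAt M (H s) s := fun s => (hHc.integral_hasStrictDerivAt 0 s).hasDerivAt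
  have inner : ∀ s ∈ Set.uIcc 0 T, ∫ r in (0 : ℝ)..T, g s * g r * min s r = g s * M s := by
    intro s hs
    rw [Set.uIcc_of_le hT] at hs
    have hcont : Continuous fun r => g r * min s r := by fun_prop
    have i1 : ∫ r in (0 : ℝ)..s, g r * min s r = M s - s * H s := by
      have : ∫ r in (0 : ℝ)..s, g r * min s r = ∫ r in (0 : ℝ)..s, g r * r := by
        refine intervalIntegral.integral_congr fun r hr => ?_
        rw [Set.uIcc_of_le hs.1] at hr
        simp only [min_eq_right hr.2]
      rw [this, intervalIntegral.integral_eq_sub_of_hasDerivAt (f := fun r => M r - r * H r)]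
      · simp [hM]
      · intro r _
        refine ((hMd r).sub ((hasDerivAt_id r).mul (hH r))).congr_deriv ?_
        simp only [id]; ring
      · exact (hg.mul continuous_id).intervalIntegrable _ _
    have i2 : ∫ r in s..T, g r * min s r = s * H s := by
      have : ∫ r in s..T, g r * min s r = ∫ r in s..T, g r * s := by
        refine intervalIntegral.integral_congr fun r hr => ?_
        rw [Set.uIcc_of_le hs.2] at hr
        simp only [min_eq_left hr.1]
      rw [this, intervalIntegral.integral_eq_sub_of_hasDerivAt (f := fun r => - (H r * s))]
      · simp [hHT]; ring
      · intro r _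
        refine ((hH r).mul_const s).neg.congr_deriv ?_
        ring
      · exact (hg.mul continuous_const).intervalIntegrable _ _
    simp_rw [mul_assoc]
    rw [intervalIntegral.integral_const_mul, ← intervalIntegral.integral_add_adjacent_intervals
      (hcont.intervalIntegrable 0 s) (hcont.intervalIntegrable s T), i1, i2]
    ring
  rw [intervalIntegral.integral_congr inner]
  have hMc : Continuous M := continuous_iff_continuousAt.2 fun t => (hMd t).continuousAt
  have key : ∫ s in (0 : ℝ)..T, (H s ^ 2 - g s * M s) = 0 := by
    rw [intervalIntegral.integral_eq_sub_of_hasDerivAt (f := fun r => H r * M r)]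
    · simp [hHT, hM]
    · intro r _
      refine ((hH r).mul (hMd r)).congr_deriv ?_
      ring
    · exact Continuous.intervalIntegrable (by fun_prop) _ _
  rw [intervalIntegral.integral_sub (Continuous.intervalIntegrable (by fun_prop) _ _)
    (Continuous.intervalIntegrable (by fun_prop) _ _)] at key
  linarith

/-! ### Second moments of integrated and perturbed processes -/

section Probability

variable {Ω : Type*} [MeasurableSpace Ω] {P : Measure Ω}

/-- A process with almost surely continuous paths is indistinguishable from a jointly measurable
one. Joint measurability is what Fubini's theorem needs. -/
theorem exists_measurable_uncurry_ae_eq {F : ℝ → Ω → ℝ} (hF : ∀ s, AEMeasurable (F s) P)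
    (hc : ∀ᵐ ω ∂P, Continuous fun s => F s ω) :
    ∃ F' : ℝ → Ω → ℝ, Measurable (Function.uncurry F') ∧ ∀ᵐ ω ∂P, ∀ s, F' s ω = F s ω := by
  have hp : ∀ᵐ ω ∂P, (Continuous fun s => F s ω) ∧ ∀ q : ℚ, F q ω = (hF q).mk (F q) ω :=
    hc.and (ae_all_iff.2 fun q => (hF q).ae_eq_mk)
  obtain ⟨N, hN, hNm, hN0⟩ := exists_measurable_superset_of_null hp
  have hS : ∀ ω ∈ Nᶜ, (Continuous fun s => F s ω) ∧ ∀ q : ℚ, F q ω = (hF q).mk (F q) ω := by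
    intro ω hω
    by_contra h
    exact hω (hN h)
  refine ⟨fun s => Nᶜ.indicator (F s), ?_, ?_⟩
  · refine measurable_uncurry_of_continuous_of_measurable (fun ω => ?_) (fun s => ?_)
    · by_cases hω : ω ∈ Nᶜ
      · simpa [Set.indicator_of_mem hω] using (hS ω hω).1
      · simpa [Set.indicator_of_notMem hω] using continuous_const
    · obtain ⟨x, hx, hxs⟩ := mem_closure_iff_seq_limit.1 (Rat.denseRange_cast (𝕜 := ℝ) s)
      choose q hq using hx
      refine measurable_of_tendsto_metrizable
        (f := fun n => Nᶜ.indicator ((hF (q n)).mk (F (q n)))) (fun n =>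
          (hF (q n)).measurable_mk.indicator hNm.compl) (tendsto_pi_nhds.2 fun ω => ?_)
      by_cases hω : ω ∈ Nᶜ
      · simp only [Set.indicator_of_mem hω, ← (hS ω hω).2]
        simp only [hq]
        exact ((hS ω hω).1.tendsto s).comp hxs
      · simp [Set.indicator_of_notMem hω]
  · have : ∀ᵐ ω ∂P, ω ∈ Nᶜ := measure_eq_zero_iff_ae_notMem.1 hN0
    filter_upwards [this] with ω hω s using Set.indicator_of_mem hω _

/-- The second moment of a time integral of a process is the double integral of its second-moment
kernel `K`. -/
theorem integrable_and_integral_sq_integral [SFinite P] {F : ℝ → Ω → ℝ}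
    (hF : ∀ s, MemLp (F s) 2 P)
    (hc : ∀ᵐ ω ∂P, Continuous fun s => F s ω) {K : ℝ → ℝ → ℝ}
    (hKc : Continuous fun s => K s s)
    {T : ℝ} (hT : 0 ≤ T)
    (hK : ∀ s ∈ Set.Ioc 0 T, ∀ r ∈ Set.Ioc 0 T, ∫ ω, F s ω * F r ω ∂P = K s r) :
    Integrable (fun ω => (∫ s in (0 : ℝ)..T, F s ω) ^ 2) P ∧
      ∫ ω, (∫ s in (0 : ℝ)..T, F s ω) ^ 2 ∂P
        = ∫ s in (0 : ℝ)..T, ∫ r in (0 : ℝ)..T, K s r := by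
  obtain ⟨F', hF'm, hF'⟩ := exists_measurable_uncurry_ae_eq (fun s => (hF s).aemeasurable) hc
  set μ : Measure ℝ := volume.restrict (Set.Ioc 0 T) with hμ
  have hF's : ∀ s, F' s =ᵐ[P] F s := fun s => by filter_upwards [hF'] with ω h using h s
  have hF'2 : ∀ s, MemLp (F' s) 2 P := fun s => (memLp_congr_ae (hF's s)).2 (hF s)
  have hK' : ∀ s ∈ Set.Ioc 0 T, ∀ r ∈ Set.Ioc 0 T, ∫ ω, F' s ω * F' r ω ∂P = K s r := by
    intro s hs r hr
    rw [← hK s hs r hr]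
    refine integral_congr_ae ?_
    filter_upwards [hF'] with ω h
    rw [h, h]
  set G : Ω → ℝ × ℝ → ℝ := fun ω z => F' z.1 ω * F' z.2 ω with hG
  have hGm : Measurable (Function.uncurry G) := by
    have h1 : Measurable fun p : Ω × ℝ × ℝ => F' p.2.1 p.1 :=
      hF'm.comp (measurable_snd.fst.prodMk measurable_fst)
    have h2 : Measurable fun p : Ω × ℝ × ℝ => F' p.2.2 p.1 :=
      hF'm.comp (measurable_snd.snd.prodMk measurable_fst)
    exact h1.mul h2
  obtain ⟨C, hC⟩ := (isCompact_Icc (a := (0 : ℝ)) (b := T)).exists_bound_of_continuousOn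
    hKc.continuousOn
  have hmem : ∀ᵐ z ∂μ.prod μ, z.1 ∈ Set.Ioc 0 T ∧ z.2 ∈ Set.Ioc 0 T := by
    rw [hμ, Measure.prod_restrict]
    exact ae_restrict_mem (measurableSet_Ioc.prod measurableSet_Ioc)
  -- `|F' s * F' r|` is at most the mean of the two squares, whose expectation is bounded by `C`.
  have hGi : Integrable (Function.uncurry G) (P.prod (μ.prod μ)) := by
    rw [integrable_prod_iff' hGm.aestronglyMeasurable]
    refine ⟨Eventually.of_forall fun z => (hF'2 z.1).integrable_mul (hF'2 z.2), ?_⟩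
    refine Integrable.mono' (g := fun _ => C) (integrable_const C) ?_ ?_
    · exact (hGm.norm.stronglyMeasurable.integral_prod_left').aestronglyMeasurable
    · filter_upwards [hmem] with z hz
      rw [Real.norm_of_nonneg (by positivity)]
      have i1 := (hF'2 z.1).integrable_sq
      have i2 := (hF'2 z.2).integrable_sq
      have e : ∀ s ∈ Set.Ioc 0 T, ∫ ω, F' s ω ^ 2 ∂P ≤ C := by
        intro s hs
        simp_rw [sq]
        rw [hK' s hs s hs]
        exact (le_abs_self _).trans (hC s ⟨hs.1.le, hs.2⟩)
      calc ∫ ω, ‖Function.uncurry G (ω, z)‖ ∂P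
          ≤ ∫ ω, (1 / 2 * F' z.1 ω ^ 2 + 1 / 2 * F' z.2 ω ^ 2) ∂P := by
            refine integral_mono ((hF'2 z.1).integrable_mul (hF'2 z.2)).norm
              ((i1.const_mul _).add (i2.const_mul _)) fun ω => ?_
            simp only [Function.uncurry, hG, norm_mul, Real.norm_eq_abs]
            nlinarith [sq_nonneg (|F' z.1 ω| - |F' z.2 ω|), sq_abs (F' z.1 ω), sq_abs (F' z.2 ω)]
        _ ≤ C := by
            rw [integral_add (i1.const_mul _) (i2.const_mul _), integral_const_mul,
              integral_const_mul]
            linarith [e _ hz.1, e _ hz.2]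
  have hsq : (fun ω => (∫ s in (0 : ℝ)..T, F s ω) ^ 2) =ᵐ[P] fun ω => ∫ z, G ω z ∂μ.prod μ := by
    filter_upwards [hF'] with ω h
    rw [hG, integral_prod_mul (fun s => F' s ω) (fun s => F' s ω), sq,
      intervalIntegral.integral_of_le hT]
    simp_rw [h]
    rfl
  refine ⟨(integrable_congr hsq).2 hGi.integral_prod_left, ?_⟩
  have hKG : (fun z => ∫ ω, G ω z ∂P) =ᵐ[μ.prod μ] fun z => K z.1 z.2 := by
    filter_upwards [hmem] with z hz using hK' _ hz.1 _ hz.2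
  rw [integral_congr_ae hsq, integral_integral_swap hGi, integral_congr_ae hKG, integral_prod]
  · simp_rw [intervalIntegral.integral_of_le hT]
    rfl
  · exact (integrable_congr hKG).1 hGi.integral_prod_right

/-- Cauchy–Schwarz for real random variables: the discriminant of `x ↦ E[(f + x g)²]` is not
positive. -/
theorem sq_integral_mul_le {f g : Ω → ℝ} (hf : MemLp f 2 P) (hg : MemLp g 2 P) :
    (∫ ω, f ω * g ω ∂P) ^ 2 ≤ (∫ ω, f ω ^ 2 ∂P) * ∫ ω, g ω ^ 2 ∂P := by
  have hfg : Integrable (fun ω => f ω * g ω) P := hf.integrable_mul hg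
  have hq : ∀ x : ℝ, 0 ≤ (∫ ω, g ω ^ 2 ∂P) * (x * x) + (2 * ∫ ω, f ω * g ω ∂P) * x
      + ∫ ω, f ω ^ 2 ∂P := by
    intro x
    have h0 : 0 ≤ ∫ ω, (f ω + x * g ω) ^ 2 ∂P := integral_nonneg fun ω => sq_nonneg _
    have e : ∫ ω, (f ω + x * g ω) ^ 2 ∂P
        = ∫ ω, (x * x * g ω ^ 2 + 2 * x * (f ω * g ω) + f ω ^ 2) ∂P :=
      integral_congr_ae (Eventually.of_forall fun ω => by ring)
    rw [e, integral_add (by exact (hg.integrable_sq.const_mul _).add (hfg.const_mul _))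
      hf.integrable_sq, integral_add (hg.integrable_sq.const_mul _) (hfg.const_mul _),
      integral_const_mul, integral_const_mul] at h0
    linarith
  have := discrim_le_zero hq
  rw [discrim] at this
  linarith

/-- A perturbation that vanishes in `L²` does not change the limit of second moments, whatever its
correlation with the main term. -/
theorem tendsto_integral_sq_add {ι : Type*} {l : Filter ι} {R Z : ι → Ω → ℝ} {c : ℝ}
    (hR : ∀ t, MemLp (R t) 2 P) (hZ : ∀ t, MemLp (Z t) 2 P)
    (hR0 : Tendsto (fun t => ∫ ω, R t ω ^ 2 ∂P) l (𝓝 0))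
    (hZc : Tendsto (fun t => ∫ ω, Z t ω ^ 2 ∂P) l (𝓝 c)) :
    Tendsto (fun t => ∫ ω, (R t ω + Z t ω) ^ 2 ∂P) l (𝓝 c) := by
  have hm : Tendsto (fun t => ∫ ω, R t ω * Z t ω ∂P) l (𝓝 0) := by
    refine tendsto_zero_of_tendsto_sq (squeeze_zero (fun t => sq_nonneg _)
      (fun t => sq_integral_mul_le (hR t) (hZ t)) ?_)
    simpa using hR0.mul hZc
  have e : ∀ t, ∫ ω, (R t ω + Z t ω) ^ 2 ∂P
      = ∫ ω, R t ω ^ 2 ∂P + 2 * ∫ ω, R t ω * Z t ω ∂P + ∫ ω, Z t ω ^ 2 ∂P := by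
    intro t
    have hRZ : Integrable (fun ω => R t ω * Z t ω) P := (hR t).integrable_mul (hZ t)
    rw [← integral_const_mul, ← integral_add (hR t).integrable_sq (hRZ.const_mul 2),
      ← integral_add (by exact (hR t).integrable_sq.add (hRZ.const_mul 2)) (hZ t).integrable_sq]
    exact integral_congr_ae (Eventually.of_forall fun ω => by ring)
  simp_rw [e]
  simpa using (hR0.add (hm.const_mul 2)).add hZc

theorem tendsto_integral_sq_sum {ι κ : Type*} [Fintype κ] {l : Filter ι} {ξ : κ → Ω → ℝ}
    (hξ : ∀ i, MemLp (ξ i) 2 P) {ρ : κ → ι → ℝ} (hρ : ∀ i, Tendsto (ρ i) l (𝓝 0)) :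
    Tendsto (fun t => ∫ ω, (∑ i, ρ i t * ξ i ω) ^ 2 ∂P) l (𝓝 0) := by
  have e : ∀ t, ∫ ω, (∑ i, ρ i t * ξ i ω) ^ 2 ∂P
      = ∑ i, ∑ j, ρ i t * ρ j t * ∫ ω, ξ i ω * ξ j ω ∂P := by
    intro t
    have hi : ∀ i j, Integrable (fun ω => ρ i t * ρ j t * (ξ i ω * ξ j ω)) P := fun i j =>
      ((hξ i).integrable_mul (hξ j)).const_mul _
    simp_rw [← integral_const_mul]
    simp_rw [← integral_finsetSum Finset.univ fun j _ => hi _ j]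
    rw [← integral_finsetSum Finset.univ fun i _ => integrable_finsetSum _ fun j _ => hi i j]
    refine integral_congr_ae (Eventually.of_forall fun ω => ?_)
    simp only [sq, Finset.sum_mul_sum]
    exact Finset.sum_congr rfl fun i _ => Finset.sum_congr rfl fun j _ => by ring
  simp_rw [e]
  have : Tendsto (fun t => ∑ i, ∑ j, ρ i t * ρ j t * ∫ ω, ξ i ω * ξ j ω ∂P) l
      (𝓝 (∑ i : κ, ∑ j : κ, 0 * 0 * ∫ ω, ξ i ω * ξ j ω ∂P)) :=
    tendsto_finsetSum _ fun i _ => tendsto_finsetSum _ fun j _ =>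
      ((hρ i).mul (hρ j)).mul_const _
  simpa using this

end Probability

/-! ### Spectral decomposition of the Laplacian -/

section Spectral

variable {V : Type*} [Fintype V] [DecidableEq V] (G : SimpleGraph V) [DecidableRel G.Adj]

/-- An orthogonal matrix whose columns are eigenvectors of the Laplacian, the modes; modes are
indexed by the vertices. -/
noncomputable def modeMatrix : Matrix V V ℝ :=
  ((G.isHermitian_lapMatrix (R := ℝ)).eigenvectorUnitary : Matrix V V ℝ)

/-- The Laplacian eigenvalue of each mode, in the same indexing as `modeMatrix`. -/
noncomputable def modeEigenvalue : V → ℝ :=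
  (G.isHermitian_lapMatrix (R := ℝ)).eigenvalues

theorem transpose_modeMatrix_mul_self : (modeMatrix G)ᵀ * modeMatrix G = 1 := by
  have h := Unitary.coe_star_mul_self (G.isHermitian_lapMatrix (R := ℝ)).eigenvectorUnitary
  rwa [Matrix.star_eq_conjTranspose, Matrix.conjTranspose_eq_transpose_of_trivial] at h

theorem modeMatrix_mul_transpose : modeMatrix G * (modeMatrix G)ᵀ = 1 :=
  mul_eq_one_comm.1 (transpose_modeMatrix_mul_self G)

theorem lapMatrix_eq_modeMatrix_mul :
    G.lapMatrix ℝ = modeMatrix G * Matrix.diagonal (modeEigenvalue G) * (modeMatrix G)ᵀ := by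
  have h := (G.isHermitian_lapMatrix (R := ℝ)).spectral_theorem
  rw [Unitary.conjStarAlgAut_apply, Matrix.star_eq_conjTranspose,
    Matrix.conjTranspose_eq_transpose_of_trivial] at h
  exact h

theorem modeEigenvalue_nonneg (n : V) : 0 ≤ modeEigenvalue G n :=
  (G.posSemidef_lapMatrix ℝ).eigenvalues_nonneg n

theorem sum_modeMatrix_mul_modeMatrix_col (m n : V) :
    ∑ v, modeMatrix G v m * modeMatrix G v n = if m = n then 1 else 0 := by
  simpa [Matrix.mul_apply, Matrix.one_apply] using
    congr_fun₂ (transpose_modeMatrix_mul_self G) m n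

/-- Expansion of a vector in the modes. -/
theorem sum_modeMatrix_mul_sum (x : V → ℝ) (j : V) :
    ∑ n, modeMatrix G j n * ∑ v, modeMatrix G v n * x v = x j := by
  have := congr_fun (congr_arg (· *ᵥ x) (modeMatrix_mul_transpose G)) j
  simp only [← Matrix.mulVec_mulVec, Matrix.one_mulVec] at this
  exact this

theorem sum_modeMatrix_mul_lapMatrix_mulVec (x : V → ℝ) (n : V) :
    ∑ v, modeMatrix G v n * (G.lapMatrix ℝ *ᵥ x) v
      = modeEigenvalue G n * ∑ v, modeMatrix G v n * x v := by
  have h : (modeMatrix G)ᵀ * G.lapMatrix ℝ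
      = Matrix.diagonal (modeEigenvalue G) * (modeMatrix G)ᵀ := by
    rw [lapMatrix_eq_modeMatrix_mul, Matrix.mul_assoc, ← Matrix.mul_assoc,
      transpose_modeMatrix_mul_self, Matrix.one_mul]
  have := congr_fun (congr_arg (· *ᵥ x) h) n
  simp only [← Matrix.mulVec_mulVec] at this
  rw [Matrix.mulVec_diagonal] at this
  exact this

/-- On a connected graph a mode in the kernel of the Laplacian is constant, hence invisible in
differences of coordinates. -/
theorem modeMatrix_eq_of_modeEigenvalue_eq_zero (hG : G.Connected) {n : V}
    (hn : modeEigenvalue G n = 0) (j k : V) : modeMatrix G j n = modeMatrix G k n := by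
  have h : G.lapMatrix ℝ *ᵥ (fun v => modeMatrix G v n) = 0 := by
    have h1 := (G.isHermitian_lapMatrix (R := ℝ)).mulVec_eigenvectorBasis n
    have h2 : (G.isHermitian_lapMatrix (R := ℝ)).eigenvalues n = 0 := hn
    rw [h2, zero_smul] at h1
    exact h1
  exact (G.lapMatrix_mulVec_eq_zero_iff_forall_reachable).1 h j k (hG.preconnected j k)

/-- Modes with eigenvalue `0` contribute `0` here, by the convention `0⁻¹ = 0`, just as in the
pseudo-inverse. -/
theorem biharmonicDist_sq (j k : V) :
    biharmonicDist G j k ^ 2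
      = ∑ n, (modeMatrix G j n - modeMatrix G k n) ^ 2 * (modeEigenvalue G n)⁻¹ ^ 2 := by
  have h : lapPinv G ^ 2 = modeMatrix G * Matrix.diagonal (fun n => (modeEigenvalue G n)⁻¹ ^ 2)
      * (modeMatrix G)ᵀ := by
    have h1 : lapPinv G = modeMatrix G * Matrix.diagonal (fun n => (modeEigenvalue G n)⁻¹)
      * (modeMatrix G)ᵀ := rfl
    calc lapPinv G ^ 2 = modeMatrix G * Matrix.diagonal (fun n => (modeEigenvalue G n)⁻¹)
          * ((modeMatrix G)ᵀ * modeMatrix G) * Matrix.diagonal (fun n => (modeEigenvalue G n)⁻¹)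
          * (modeMatrix G)ᵀ := by rw [sq, h1]; simp only [Matrix.mul_assoc]
      _ = _ := by
        rw [transpose_modeMatrix_mul_self, Matrix.mul_one, Matrix.mul_assoc (modeMatrix G),
          Matrix.diagonal_mul_diagonal]
        simp only [sq]
  have he : ∀ u v, (lapPinv G ^ 2) u v
      = ∑ n, modeMatrix G u n * (modeEigenvalue G n)⁻¹ ^ 2 * modeMatrix G v n := by
    intro u v
    rw [h, Matrix.mul_apply]
    simp only [Matrix.mul_diagonal, Matrix.transpose_apply]
  have hs : (lapPinv G ^ 2) j j + (lapPinv G ^ 2) k k - 2 * (lapPinv G ^ 2) j k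
      = ∑ n, (modeMatrix G j n - modeMatrix G k n) ^ 2 * (modeEigenvalue G n)⁻¹ ^ 2 := by
    rw [he, he, he, Finset.mul_sum, ← Finset.sum_add_distrib, ← Finset.sum_sub_distrib]
    exact Finset.sum_congr rfl fun n _ => by ring
  rw [biharmonicDist, hs, Real.sq_sqrt (Finset.sum_nonneg fun n _ => by positivity)]

end Spectral

/-! ### Solution formula for a path -/

section Pathwise

variable {V : Type*} [Fintype V] [DecidableEq V] (G : SimpleGraph V) [DecidableRel G.Adj]

theorem driftMatrix_mulVec_inl (x : V ⊕ V → ℝ) (v : V) :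
    (driftMatrix G *ᵥ x) (Sum.inl v) = x (Sum.inr v) := by
  simp [driftMatrix, Matrix.fromBlocks_mulVec]

theorem driftMatrix_mulVec_inr (x : V ⊕ V → ℝ) (v : V) :
    (driftMatrix G *ᵥ x) (Sum.inr v)
      = -(G.lapMatrix ℝ *ᵥ (x ∘ Sum.inl)) v - (G.lapMatrix ℝ *ᵥ (x ∘ Sum.inr)) v := by
  simp [driftMatrix, Matrix.fromBlocks_mulVec, Matrix.neg_mulVec, sub_eq_add_neg]

theorem inputMatrix_mulVec_inl (w : V → ℝ) (v : V) :
    (inputMatrix V *ᵥ w) (Sum.inl v) = 0 := by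
  simp [inputMatrix, Matrix.fromRows_mulVec]

theorem inputMatrix_mulVec_inr (w : V → ℝ) (v : V) :
    (inputMatrix V *ᵥ w) (Sum.inr v) = w v := by
  simp [inputMatrix, Matrix.fromRows_mulVec]

/-- The position of mode `n` along a single path `x` driven by `w`. -/
theorem mode_eq_add_integral {x : ℝ≥0 → V ⊕ V → ℝ} {w : ℝ≥0 → V → ℝ} (hx : Continuous x)
    (hw : ∀ v, Continuous fun t => w t v)
    (heq : ∀ (t : ℝ≥0) (i : V ⊕ V),
      x t i = x 0 i + (∫ s in (0 : ℝ)..t, (driftMatrix G *ᵥ x s.toNNReal) i)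
        + (inputMatrix V *ᵥ w t) i)
    {n : V} {a h : ℝ → ℝ} (H : IsModeResponse (modeEigenvalue G n) a h) (t : ℝ≥0) :
    ∑ v, modeMatrix G v n * x t (Sum.inl v)
      = a t * (∑ v, modeMatrix G v n * x 0 (Sum.inl v))
        + h t * (∑ v, modeMatrix G v n * x 0 (Sum.inr v))
        + ∫ s in (0 : ℝ)..t, (a (t - s) - modeEigenvalue G n * h (t - s))
          * ∑ v, modeMatrix G v n * w s.toNNReal v := by
  have hxr : Continuous fun s : ℝ => x s.toNNReal := hx.comp continuous_real_toNNReal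
  have hxi : ∀ i, Continuous fun s : ℝ => x s.toNNReal i := fun i => (continuous_apply i).comp hxr
  have hwi : ∀ v, Continuous fun s : ℝ => w s.toNNReal v := fun v =>
    (hw v).comp continuous_real_toNNReal
  have hdc : ∀ i, Continuous fun s : ℝ => (driftMatrix G *ᵥ x s.toNNReal) i := fun i =>
    (continuous_apply i).comp (continuous_const.matrix_mulVec hxr)
  have hsum : ∀ (f : V → ℝ → ℝ) (_ : ∀ v, Continuous (f v)) (T : ℝ),
      ∑ v, modeMatrix G v n * ∫ s in (0 : ℝ)..T, f v s
        = ∫ s in (0 : ℝ)..T, ∑ v, modeMatrix G v n * f v s := by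
    intro f hf T
    rw [intervalIntegral.integral_finsetSum fun v _ =>
      Continuous.intervalIntegrable (by fun_prop) _ _]
    simp only [intervalIntegral.integral_const_mul]
  have key := H.eq_add_integral
    (y := fun s => ∑ v, modeMatrix G v n * x s.toNNReal (Sum.inl v))
    (z := fun s => ∑ v, modeMatrix G v n * x s.toNNReal (Sum.inr v))
    (b := fun s => ∑ v, modeMatrix G v n * w s.toNNReal v)
    (by fun_prop) (by fun_prop) (by fun_prop) ?_ ?_ t.coe_nonneg
  · simpa using key
  · intro T hT
    lift T to ℝ≥0 using hT
    have e : ∀ v, x T (Sum.inl v) = x 0 (Sum.inl v)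
        + ∫ s in (0 : ℝ)..T, x s.toNNReal (Sum.inr v) := fun v => by
      have := heq T (Sum.inl v)
      simp only [driftMatrix_mulVec_inl, inputMatrix_mulVec_inl, add_zero] at this
      exact this
    simp only [Real.toNNReal_coe, Real.toNNReal_zero]
    simp_rw [e, mul_add]
    rw [Finset.sum_add_distrib, hsum _ fun v => hxi _]
  · intro T hT
    lift T to ℝ≥0 using hT
    have e := fun v => heq T (Sum.inr v)
    simp only [inputMatrix_mulVec_inr] at e
    simp only [Real.toNNReal_coe, Real.toNNReal_zero]
    simp_rw [e, mul_add]
    rw [Finset.sum_add_distrib, Finset.sum_add_distrib, hsum _ fun v => hdc _]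
    congr 3
    funext s
    simp only [driftMatrix_mulVec_inr, mul_sub, mul_neg, Finset.sum_sub_distrib,
      Finset.sum_neg_distrib, sum_modeMatrix_mul_lapMatrix_mulVec, Function.comp_apply]
    ring

end Pathwise

/-! ### Second moments of the noise -/

section Noise

variable {V Ω : Type*} [MeasurableSpace Ω] {P : Measure Ω}

theorem IsIntegratedWhiteNoise.memLp {W : ℝ≥0 → Ω → V → ℝ} (hW : IsIntegratedWhiteNoise P W)
    (t : ℝ≥0) (v : V) : MemLp (fun ω => W t ω v) 2 P :=
  ((hW.isBrownian v).hasLaw_eval t).hasGaussianLaw.memLp_two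

theorem IsIntegratedWhiteNoise.integral_mul [DecidableEq V] {W : ℝ≥0 → Ω → V → ℝ}
    (hW : IsIntegratedWhiteNoise P W) (s t : ℝ≥0) (u v : V) :
    ∫ ω, W s ω u * W t ω v ∂P = if u = v then min (s : ℝ) t else 0 := by
  have h0 : ∀ (r : ℝ≥0) (w : V), ∫ ω, W r ω w ∂P = 0 := fun r w =>
    (hW.isBrownian w).integral_eval r
  have hc : ∫ ω, W s ω u * W t ω v ∂P = cov[fun ω => W s ω u, fun ω => W t ω v; P] := by
    simp [covariance, h0]
  rw [hc]
  split_ifs with huv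
  · subst huv
    simpa using (hW.isBrownian u).covariance_fun_eval s t
  · exact hW.uncorrelated u v huv s t

/-- The Itô isometry for `∑ᵥ ∫₀ᵀ Hᵥ dWᵥ`, with `Hᵥ(T) = 0` and the stochastic integral written after
integration by parts as `∑ᵥ ∫₀ᵀ gᵥ(s) Wᵥ(s) ds`, where `g = -H'`. -/
theorem IsIntegratedWhiteNoise.integral_sq_integral [Fintype V] [SFinite P] {W : ℝ≥0 → Ω → V → ℝ}
    (hW : IsIntegratedWhiteNoise P W) {g H : V → ℝ → ℝ} (hg : ∀ v, Continuous (g v))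
    (hH : ∀ v s, HasDerivAt (H v) (-g v s) s) {T : ℝ} (hT : 0 ≤ T) (hHT : ∀ v, H v T = 0) :
    Integrable (fun ω => (∫ s in (0 : ℝ)..T, ∑ v, g v s * W s.toNNReal ω v) ^ 2) P ∧
      ∫ ω, (∫ s in (0 : ℝ)..T, ∑ v, g v s * W s.toNNReal ω v) ^ 2 ∂P
        = ∫ s in (0 : ℝ)..T, ∑ v, H v s ^ 2 := by
  classical
  have hHc : ∀ v, Continuous (H v) := fun v =>
    continuous_iff_continuousAt.2 fun s => (hH v s).continuousAt
  have hcont : ∀ᵐ ω ∂P, Continuous fun s : ℝ => ∑ v, g v s * W s.toNNReal ω v := by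
    filter_upwards [ae_all_iff.2 fun v => (hW.isBrownian v).cont] with ω hω
    refine continuous_finsetSum _ fun v _ => (hg v).mul ((hω v).comp continuous_real_toNNReal)
  have hcov : ∀ s ∈ Set.Ioc 0 T, ∀ r ∈ Set.Ioc 0 T,
      ∫ ω, (∑ v, g v s * W s.toNNReal ω v) * (∑ v, g v r * W r.toNNReal ω v) ∂P
        = ∑ v, g v s * g v r * min s r := by
    intro s hs r hr
    have hi : ∀ u v, Integrable
        (fun ω => g u s * g v r * (W s.toNNReal ω u * W r.toNNReal ω v)) P := fun u v =>
      ((hW.memLp _ u).integrable_mul (hW.memLp _ v)).const_mul _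
    have e : ∀ ω, (∑ v, g v s * W s.toNNReal ω v) * (∑ v, g v r * W r.toNNReal ω v)
        = ∑ u, ∑ v, g u s * g v r * (W s.toNNReal ω u * W r.toNNReal ω v) := fun ω => by
      rw [Finset.sum_mul_sum]
      exact Finset.sum_congr rfl fun i _ => Finset.sum_congr rfl fun j _ => by ring
    simp_rw [e]
    rw [integral_finsetSum _ fun u _ => integrable_finsetSum _ fun v _ => hi u v]
    refine Finset.sum_congr rfl fun u _ => ?_
    rw [integral_finsetSum _ fun v _ => hi u v]
    simp [integral_const_mul, hW.integral_mul, hs.1.le, hr.1.le]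
  obtain ⟨h1, h2⟩ := integrable_and_integral_sq_integral
    (K := fun s r => ∑ v, g v s * g v r * min s r)
    (fun s => memLp_finsetSum _ fun v _ => (hW.memLp s.toNNReal v).const_mul (g v s)) hcont
    (by fun_prop) hT hcov
  refine ⟨h1, h2.trans ?_⟩
  have hi : ∀ v s, IntervalIntegrable (fun r => g v s * g v r * min s r) volume 0 T :=
    fun v s => Continuous.intervalIntegrable (by fun_prop) _ _
  simp_rw [intervalIntegral.integral_finsetSum fun v _ => hi v _]
  rw [intervalIntegral.integral_finsetSum, intervalIntegral.integral_finsetSum]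
  · exact Finset.sum_congr rfl fun v _ =>
      integral_integral_mul_min (hg v) (hH v) hT (hHT v)
  · exact fun v _ => Continuous.intervalIntegrable (by fun_prop) _ _
  · intro v _
    refine Continuous.intervalIntegrable ?_ _ _
    refine intervalIntegral.continuous_parametric_intervalIntegral_of_continuous' ?_ _ _
    have := hg v
    fun_prop

end Noise

end Consensus

/-! ### The steady-state pairwise variance -/

open Consensus

theorem mainTheorem1 {V Ω : Type*} [Fintype V] [DecidableEq V] [MeasurableSpace Ω]
    (P : Measure Ω) [IsProbabilityMeasure P]
    (G : SimpleGraph V) [DecidableRel G.Adj] (hG : G.Connected)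
    (W : ℝ≥0 → Ω → V → ℝ) (hW : Consensus.IsIntegratedWhiteNoise P W)
    (X : ℝ≥0 → Ω → V ⊕ V → ℝ) (hX : Consensus.IsSolution P G W X)
    (hX0 : ∀ i, MemLp (fun ω => X 0 ω i) 2 P) (j k : V) :
    Consensus.HasPairwiseVariance P X j k ((1 / 2) * Consensus.biharmonicDist G j k ^ 2) := by
  choose a h H using fun n => exists_isModeResponse (modeEigenvalue G n)
  have hac := fun n => (H n).continuous_a
  have hhc := fun n => (H n).continuous_h
  set U := modeMatrix G with hU
  set l := modeEigenvalue G with hl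
  set c : V → ℝ := fun n => U j n - U k n with hc
  have hc0 : ∀ n, c n = 0 ∨ 0 < l n := fun n => by
    rcases (modeEigenvalue_nonneg G n).eq_or_lt with h0 | h0
    · exact Or.inl (sub_eq_zero.2 (modeMatrix_eq_of_modeEigenvalue_eq_zero G hG h0.symm j k))
    · exact Or.inr h0
  -- `R` is the contribution of the initial state, with weights `ρ`, and `Z` that of the noise.
  set ρ : V ⊕ V → ℝ≥0 → ℝ := fun i t =>
    Sum.elim (fun v => ∑ n, c n * a n t * U v n) (fun v => ∑ n, c n * h n t * U v n) i with hρ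
  set g : ℝ≥0 → V → ℝ → ℝ := fun t v s => ∑ n, c n * U v n * (a n (t - s) - l n * h n (t - s))
    with hg
  set R : ℝ≥0 → Ω → ℝ := fun t ω => ∑ i, ρ i t * X 0 ω i with hR
  set Z : ℝ≥0 → Ω → ℝ := fun t ω => ∫ s in (0 : ℝ)..t, ∑ v, g t v s * W s.toNNReal ω v with hZ
  have hgc : ∀ t v, Continuous (g t v) := fun t v => by fun_prop
  have hdec : ∀ t, (fun ω => X t ω (Sum.inl j) - X t ω (Sum.inl k)) =ᵐ[P]
      fun ω => R t ω + Z t ω := by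
    intro t
    filter_upwards [hX.continuous_paths, hX.equation,
      ae_all_iff.2 fun v => (hW.isBrownian v).cont] with ω h1 h2 h3
    have hm := fun n => mode_eq_add_integral G h1 h3 h2 (H n) t
    have hWc : ∀ v, Continuous fun s : ℝ => W s.toNNReal ω v := fun v =>
      (h3 v).comp continuous_real_toNNReal
    have e1 : X t ω (Sum.inl j) - X t ω (Sum.inl k)
        = ∑ n, c n * ∑ v, U v n * X t ω (Sum.inl v) := by
      rw [← sum_modeMatrix_mul_sum G (fun v => X t ω (Sum.inl v)) j,
        ← sum_modeMatrix_mul_sum G (fun v => X t ω (Sum.inl v)) k, ← Finset.sum_sub_distrib]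
      exact Finset.sum_congr rfl fun n _ => by simp only [hc, sub_mul, hU]
    have e2 : Z t ω = ∑ n, c n * ∫ s in (0 : ℝ)..t, (a n (t - s) - l n * h n (t - s))
        * ∑ v, U v n * W s.toNNReal ω v := by
      simp_rw [← intervalIntegral.integral_const_mul]
      rw [← intervalIntegral.integral_finsetSum fun n _ =>
        Continuous.intervalIntegrable (by fun_prop) _ _]
      refine intervalIntegral.integral_congr fun s _ => ?_
      simp only [hg, Finset.sum_mul, Finset.mul_sum]
      rw [Finset.sum_comm]
      exact Finset.sum_congr rfl fun n _ => Finset.sum_congr rfl fun v _ => by ring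
    have e3 : R t ω = ∑ n, c n * (a n t * ∑ v, U v n * X 0 ω (Sum.inl v))
        + ∑ n, c n * (h n t * ∑ v, U v n * X 0 ω (Sum.inr v)) := by
      simp only [hR, Fintype.sum_sum_type, hρ, Sum.elim_inl, Sum.elim_inr, Finset.sum_mul,
        Finset.mul_sum]
      congr 1 <;>
      · rw [Finset.sum_comm]
        exact Finset.sum_congr rfl fun n _ => Finset.sum_congr rfl fun v _ => by ring
    rw [e1, e2, e3, ← Finset.sum_add_distrib, ← Finset.sum_add_distrib]
    exact Finset.sum_congr rfl fun n _ => by rw [hm n]; ring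
  have hRm : ∀ t, MemLp (R t) 2 P := fun t =>
    memLp_finsetSum _ fun i _ => (hX0 i).const_mul _
  have hZsq : ∀ t, Integrable (fun ω => Z t ω ^ 2) P ∧
      ∫ ω, Z t ω ^ 2 ∂P = ∑ n, c n ^ 2 * ∫ s in (0 : ℝ)..t, h n s ^ 2 := by
    intro t
    have hd : ∀ v s, HasDerivAt (fun s => ∑ n, c n * U v n * h n (t - s)) (-g t v s) s := by
      intro v s
      have hsub : HasDerivAt (fun s => (t : ℝ) - s) (-1) s := by
        simpa using (hasDerivAt_id s).const_sub (t : ℝ)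
      refine (HasDerivAt.fun_sum fun n _ =>
        (((H n).hasDerivAt_h (t - s)).comp s hsub).const_mul (c n * U v n)).congr_deriv ?_
      simp only [hg, ← Finset.sum_neg_distrib]
      exact Finset.sum_congr rfl fun n _ => by ring
    obtain ⟨i1, i2⟩ := hW.integral_sq_integral (hgc t) hd t.coe_nonneg
      (fun v => by simp [(H _).h_zero])
    refine ⟨i1, i2.trans ?_⟩
    -- Orthonormality of the modes removes the cross terms.
    have e : ∀ s : ℝ, ∑ v, (∑ n, c n * U v n * h n (t - s)) ^ 2
        = ∑ n, c n ^ 2 * h n (t - s) ^ 2 := by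
      intro s
      simp_rw [sq, Finset.sum_mul_sum]
      rw [Finset.sum_comm]
      refine Finset.sum_congr rfl fun m _ => ?_
      rw [Finset.sum_comm]
      have : ∀ n, ∑ v, c m * U v m * h m (t - s) * (c n * U v n * h n (t - s))
          = c m * h m (t - s) * (c n * h n (t - s)) * if m = n then 1 else 0 := fun n => by
        rw [← sum_modeMatrix_mul_modeMatrix_col G m n, Finset.mul_sum]
        exact Finset.sum_congr rfl fun v _ => by ring
      simp only [this]
      simp
      ring
    simp_rw [e]
    rw [intervalIntegral.integral_finsetSum fun n _ =>
      Continuous.intervalIntegrable (by fun_prop) _ _]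
    refine Finset.sum_congr rfl fun n _ => ?_
    rw [intervalIntegral.integral_const_mul,
      intervalIntegral.integral_comp_sub_left (fun s => h n s ^ 2)]
    simp
  -- `Z` is measurable as the difference of the observed process and `R`.
  have hZm : ∀ t, MemLp (Z t) 2 P := by
    intro t
    have hXm : ∀ i, AEMeasurable (fun ω => X t ω i) P := fun i =>
      (measurable_pi_apply i).comp_aemeasurable (hX.aemeasurable t)
    have hm : AEStronglyMeasurable (Z t) P := by
      refine (((hXm (Sum.inl j)).sub (hXm (Sum.inl k))).aestronglyMeasurable.sub
        (hRm t).aestronglyMeasurable).congr ?_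
      filter_upwards [hdec t] with ω hω
      simp only [Pi.sub_apply, hω, add_sub_cancel_left]
    exact (memLp_two_iff_integrable_sq hm).2 (hZsq t).1
  have hcoe : Tendsto ((↑) : ℝ≥0 → ℝ) atTop atTop := NNReal.tendsto_coe_atTop.2 tendsto_id
  -- Responses of modes with eigenvalue `0` need not decay, but `c` vanishes there.
  have hR0 : Tendsto (fun t => ∫ ω, R t ω ^ 2 ∂P) atTop (𝓝 0) := by
    refine tendsto_integral_sq_sum hX0 fun i => ?_
    have hlim : ∀ (f : V → ℝ → ℝ) (_ : ∀ n, 0 < l n → Tendsto (f n) atTop (𝓝 0)) (v : V),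
        Tendsto (fun t : ℝ≥0 => ∑ n, c n * f n t * U v n) atTop (𝓝 0) := by
      intro f hf v
      rw [← Finset.sum_const_zero (s := (Finset.univ : Finset V))]
      refine tendsto_finsetSum _ fun n _ => ?_
      rcases hc0 n with h0 | h0
      · simp [h0]
      · simpa using ((((hf n h0).comp hcoe).const_mul (c n)).mul_const (U v n))
    cases i with
    | inl v => exact hlim a (fun n hn => (H n).tendsto_a hn) v
    | inr v => exact hlim h (fun n hn => (H n).tendsto_h hn) v
  have hZlim : Tendsto (fun t => ∫ ω, Z t ω ^ 2 ∂P) atTop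
      (𝓝 (1 / 2 * biharmonicDist G j k ^ 2)) := by
    simp_rw [fun t => (hZsq t).2, biharmonicDist_sq, Finset.mul_sum]
    refine tendsto_finsetSum _ fun n _ => ?_
    rcases hc0 n with h0 | h0
    · have h0' : modeMatrix G j n - modeMatrix G k n = 0 := h0
      simp [h0, h0']
    · rw [mul_left_comm]
      exact (((H n).tendsto_integral_sq h0).comp hcoe).const_mul _
  refine ⟨fun t => ?_, (tendsto_integral_sq_add hRm hZm hR0 hZlim).congr fun t => ?_⟩
  · refine ((hRm t).add (hZm t)).integrable_sq.congr ?_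
    filter_upwards [hdec t] with ω hω
    simp [hω]
  · refine integral_congr_ae ?_
    filter_upwards [hdec t] with ω hω
    rw [hω]
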